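/- Let $A$ be a commutative Noetherian ring, let $\mathcal A$ be the category of $A$-modules, and let $P$ be a finite poset. Let $\operatorname{Inv}(P,\mathcal A)$ be the category of inverse systems over $P$, that is, of contravariant functors $V=(V_p)_{p\in P}$ from $P$ (with one morphism $p\to q$ whenever $p\le q$) to $\mathcal A$, and let $\lim_{p\in P}:\operatorname{Inv}(P,\mathcal A)\to\mathcal A$ be the limit functor. For ideals $J,K$ of $A$ put $$\mathbf W(J,K)=\{\mathfrak q\in\operatorname{Spec}(A)\mid J^n\subseteq\mathfrak q+K\text{ for some integer }n\ge 1\}.$$ Let $T:\mathcal A\to\mathcal A$ be a covariant, additive, left exact functor which commutes with arbitrary direct sums, and suppose that there are ideals $J,K$ of $A$ such that exactly one of the following two conditions holds, where $E(A/\mathfrak p)$ denotes the injective hull of $A/\mathfrak p$: (a) for every $\mathfrak p\in\operatorname{Spec}(A)$ and every maximal ideal $\mathfrak m$ of $A$ there is an $A$-module $X$ such that $T(E(A/\mathfrak p))_{\mathfrak m}\cong X$ if $\mathfrak p\in\mathbf W(J,K)$ and $\mathfrak p\subseteq\mathfrak m$, and $T(E(A/\mathfrak p))_{\mathfrak m}=0$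 otherwise; (b) for every $\mathfrak p\in\operatorname{Spec}(A)$ and every maximal ideal $\mathfrak m$ of $A$ there is an $A$-module $Y$ such that $T(E(A/\mathfrak p))_{\mathfrak m}\cong Y$ if $\mathfrak p\notin\mathbf W(J,K)$ and $\mathfrak p\subseteq\mathfrak m$, and $T(E(A/\mathfrak p))_{\mathfrak m}=0$ otherwise. Let $\mathcal T:\operatorname{Inv}(P,\mathcal A)\to\operatorname{Inv}(P,\mathcal A)$ be the functor $(M_p)_{p\in P}\mapsto(T(M_p))_{p\in P}$, and let $\mathbb R^j\mathcal T$ denote its right derived functors in the abelian category $\operatorname{Inv}(P,\mathcal A)$. Then for every $V\in\operatorname{Inv}(P,\mathcal A)$ there is a first quadrant cohomological spectral sequence of $A$-modules $$E_2^{i,j}=\mathbb R^i\lim_{p\in P}\,\mathbb R^j\mathcal T(V)\ \Longrightarrow\ \mathbb R^{i+j}\bigl(\lim_{p\in P}\circ\,\mathcal T\bigr)(V);$$ that is, for every $n\ge 0$ the module $H^n=\mathbb R^{n}(\lim_{p\in P}\circ\,\mathcal T)(V)$ has a filtration $H^n=F^0H^n\supseteq F^1H^n\supseteq\dots\supseteq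 F^{n+1}H^n=0$ with $F^iH^n/F^{i+1}H^n\cong E_\infty^{i,n-i}$ for $0\le i\le n$. If, in addition, there is a natural equivalence of functors $\lim_{p\in P}\circ\,\mathcal T\cong T\circ\lim_{p\in P}$, and $V$ is acyclic with respect to the limit (that is, $\mathbb R^i\lim_{p\in P}V=0$ for all $i>0$), then $\mathbb R^{n}(\lim_{p\in P}\circ\,\mathcal T)(V)\cong\mathbb R^nT(\lim_{p\in P}V_p)$ for all $n\ge0$, and the same spectral sequence takes the form $$E_2^{i,j}=\mathbb R^i\lim_{p\in P}\,\mathbb R^j\mathcal T(V)\ \Longrightarrow\ \mathbb R^{i+j}T\bigl(\lim_{p\in P}V_p\bigr).$$ -/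

import Mathlib

open CategoryTheory Limits

universe w u v v'

noncomputable section

/-- The category `Inv(P, 𝒜)` of inverse systems of `A`-modules over the poset `P`: contravariant
functors from `P` (one morphism `p ⟶ q` whenever `p ≤ q`) to `A`-modules. -/
abbrev InvSys (P : Type w) [PartialOrder P] (A : Type u) [CommRing A] :=
  Pᵒᵖ ⥤ ModuleCat.{u} A

section Inv

variable (P : Type w) [PartialOrder P] [Finite P] (A : Type u) [CommRing A]

/-- The category of inverse systems over a finite poset has enough injectives, so that
right derived functors can be formed. -/
instance InvSys.enoughInjectives : EnoughInjectives (InvSys P A) where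
  presentation V := by
    have : ∀ a b : Pᵒᵖ, HasProductsOfShape (a ⟶ b) (ModuleCat.{u} A) := fun a b =>
      hasLimitsOfShape_discrete _ (a ⟶ b)
    have hF : Finite Pᵒᵖ := Finite.of_equiv P Opposite.equivToOpposite
    have hP : HasProductsOfShape Pᵒᵖ (InvSys P A) := hasLimitsOfShape_discrete _ Pᵒᵖ
    let R : Pᵒᵖ → InvSys P A := fun p =>
      (evaluationRightAdjoint (ModuleCat.{u} A) p).obj (Injective.under (V.obj p))
    have hR : ∀ p, Injective (R p) := fun p =>
      Injective.injective_of_adjoint (evaluationAdjunctionLeft (ModuleCat.{u} A) p) _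
    let f : ∀ p, V ⟶ R p := fun p =>
      (evaluationAdjunctionLeft (ModuleCat.{u} A) p).homEquiv V _ (Injective.ι (V.obj p))
    have hf : ∀ p, (f p).app p ≫ (evaluationAdjunctionLeft (ModuleCat.{u} A) p).counit.app _ =
        Injective.ι (V.obj p) := fun p => by
      have := (evaluationAdjunctionLeft (ModuleCat.{u} A) p).homEquiv_counit
        (g := f p)
      rw [Equiv.symm_apply_apply] at this
      exact this.symm
    have hm : Mono (Pi.lift f) := by
      have : ∀ p, Mono ((Pi.lift f).app p) := fun p => by
        have h2 : (Pi.lift f).app p ≫ ((Pi.π R p).app p ≫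
            (evaluationAdjunctionLeft (ModuleCat.{u} A) p).counit.app _) =
            Injective.ι (V.obj p) := by
          rw [← hf p, ← Category.assoc, ← NatTrans.comp_app, Pi.lift_π]
        have : Mono ((Pi.lift f).app p ≫ ((Pi.π R p).app p ≫
            (evaluationAdjunctionLeft (ModuleCat.{u} A) p).counit.app _)) := by
          rw [h2]; infer_instance
        exact mono_of_mono _ ((Pi.π R p).app p ≫
            (evaluationAdjunctionLeft (ModuleCat.{u} A) p).counit.app _)
      exact NatTrans.mono_of_mono_app _
    exact ⟨⟨∏ᶜ R, inferInstance, Pi.lift f, hm⟩⟩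

/-- The limit functor `lim_{p ∈ P} : Inv(P, 𝒜) ⥤ 𝒜`. -/
abbrev InvSys.limit : InvSys P A ⥤ ModuleCat.{u} A := lim

instance InvSys.limit_additive : (InvSys.limit P A).Additive where
  map_add {X Y f g} := by
    apply limit.hom_ext
    intro j
    simp [InvSys.limit]

variable {A} in
/-- The pointwise extension `𝒯 : Inv(P, 𝒜) ⥤ Inv(P, 𝒜)`, `(M_p)_p ↦ (T(M_p))_p`, of an
endofunctor `T` of the category of `A`-modules. -/
abbrev InvSys.extend (T : ModuleCat.{u} A ⥤ ModuleCat.{u} A) : InvSys P A ⥤ InvSys P A :=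
  (Functor.whiskeringRight Pᵒᵖ _ _).obj T

end Inv

/-- The injective hull `E(M)` (up to isomorphism): `f : M ⟶ E` is an essential monomorphism into
an injective module. -/
structure IsInjectiveHull {A : Type u} [CommRing A] {M E : ModuleCat.{u} A} (f : M ⟶ E) :
    Prop where
  injective : Injective E
  mono : Mono f
  essential : ∀ N : Submodule A E, N ⊓ LinearMap.range f.hom = ⊥ → N = ⊥

/-- `𝐖(J, K)`: the primes `𝔮` such that `Jⁿ ⊆ 𝔮 + K` for some `n ≥ 1`. -/
def WSet {A : Type u} [CommRing A] (J K : Ideal A) : Set (PrimeSpectrum A) :=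
  {q | ∃ n : ℕ, 1 ≤ n ∧ J ^ n ≤ q.asIdeal ⊔ K}

/-- For every prime `𝔭` and every maximal ideal `𝔪` there is a module `X` such that
`T(E(A/𝔭))_𝔪` is `X` if `𝔭 ∈ S` and `𝔭 ⊆ 𝔪`, and is zero otherwise. -/
def LocalizedOnHulls {A : Type u} [CommRing A] (T : ModuleCat.{u} A ⥤ ModuleCat.{u} A)
    (S : Set (PrimeSpectrum A)) : Prop :=
  ∀ (p : PrimeSpectrum A) (m : MaximalSpectrum A), ∃ X : ModuleCat.{u} A,
    ∀ (E : ModuleCat.{u} A) (f : ModuleCat.of A (A ⧸ p.asIdeal) ⟶ E), IsInjectiveHull f →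
      ((p ∈ S ∧ p.asIdeal ≤ m.asIdeal) →
        Nonempty (LocalizedModule m.asIdeal.primeCompl (T.obj E) ≃ₗ[A] X)) ∧
      (¬ (p ∈ S ∧ p.asIdeal ≤ m.asIdeal) →
        Subsingleton (LocalizedModule m.asIdeal.primeCompl (T.obj E)))

/-- The standing assumptions on a (left exact, additive) functor `T`: it commutes with arbitrary
direct sums, and there are ideals `J`, `K` for which `T` satisfies exactly one of the two
conditions, on `𝐖(J, K)` and on its complement. -/
structure IsAdmissible {A : Type u} [CommRing A] (T : ModuleCat.{u} A ⥤ ModuleCat.{u} A) :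
    Prop where
  preserves_sums : ∀ ι : Type u, PreservesColimitsOfShape (Discrete ι) T
  exists_ideals : ∃ J K : Ideal A,
    Xor (LocalizedOnHulls T (WSet J K)) (LocalizedOnHulls T (WSet J K)ᶜ)

/-- A first quadrant cohomological spectral sequence `E` converges to the graded object `H`, i.e.
`E_2^{i,j} ⇒ H^{i+j}`: each `Hⁿ` has a finite decreasing filtration
`Hⁿ = F⁰Hⁿ ⊇ F¹Hⁿ ⊇ ⋯ ⊇ Fⁿ⁺¹Hⁿ = 0` with `FⁱHⁿ/Fⁱ⁺¹Hⁿ ≅ E_∞^{i,n-i}`. Here `E_∞^{i,j}` is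
`E_r^{i,j}` for any `r > max(i, j + 1)`: from there on, no differential enters or leaves the
position `(i, j)`. -/
def SpectralConvergesTo {C : Type v} [Category.{v'} C] [Abelian C]
    (E : E₂CohomologicalSpectralSequenceNat C) (H : ℕ → C) : Prop :=
  ∀ n : ℕ, ∃ (F : ℕ → Subobject (H n)) (hF : Antitone F), F 0 = ⊤ ∧ F (n + 1) = ⊥ ∧
    ∀ (i j : ℕ), i + j = n → ∀ (r : ℤ) (hr : 2 ≤ r), (i : ℤ) < r → (j : ℤ) + 1 < r →
      Nonempty (cokernel (Subobject.ofLE (F (i + 1)) (F i) (hF (Nat.le_succ i))) ≅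
        (E.page r hr).X (i, j))

end

/-! This is a Grothendieck spectral sequence for `lim ∘ 𝒯`, so the point is that `𝒯` sends injective
systems to `lim`-acyclic ones. Evaluation at `p` has a right adjoint, coinduction `coind p`. It is
exact, preserves injectives and satisfies `lim ∘ coind p ≅ 𝟭`; hence coinduced systems are
`lim`-acyclic. As `P` is finite, coinduction is built from finite products, so the additive functor
`T` commutes with it, and every injective system `I` is a retract of the finite product of the
`coind p (I_p)`. Hence `𝒯(I)` is `lim`-acyclic (`InvSys.isRightAcyclic_extend_obj`).

The spectral sequence (`exists_grothendieckSpectralSequence`) arises by applying the hypercohomology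
of `lim` to the canonical truncations of `𝒯(R)`, where `R` is an injective resolution of `V`. The
successive pieces are the objects `ℝʲ𝒯(V)[-j]`, which gives `E₂`. The abutment is identified by
`nonempty_hypercohomology_iso`: bounded below complexes of acyclic objects compute hypercohomology.
Convergence is a general fact on first quadrant spectral objects (`spectralConvergesTo`).

Finally `lim` is right adjoint to the exact constant-system functor, so it preserves injectives. For
`lim`-acyclic `V`, `lim R` is then an injective resolution of `lim V`, and applying `T` to it
computes both sides (`nonempty_rightDerived_comp_iso`). -/

noncomputable section

/-! ### Convergence of first quadrant spectral objects -/

namespace CategoryTheory.Subobject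

/-- The quotient of two nested subobjects, in terms of monomorphisms representing them. -/
def cokernelOfLEIso {C : Type u} [Category.{v} C] [Abelian C] {A B H : C}
    (a : A ⟶ H) (b : B ⟶ H) [Mono a] [Mono b] (f : A ⟶ B) (hf : f ≫ b = a)
    {S T : Subobject H} (hS : S = Subobject.mk a) (hT : T = Subobject.mk b) (h : S ≤ T) :
    cokernel (Subobject.ofLE S T h) ≅ cokernel f :=
  cokernel.mapIso _ _ (Subobject.isoOfEq _ _ hS ≪≫ Subobject.underlyingIso a)
    (Subobject.isoOfEq _ _ hT ≪≫ Subobject.underlyingIso b) (by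
      subst hS hT
      rw [← cancel_mono b]
      simp [hf])

end CategoryTheory.Subobject

namespace CategoryTheory.Abelian.SpectralObject

open ComposableArrows

variable {C : Type u} [Category.{v} C] [Abelian C] (X : SpectralObject C EInt)

/-- The inclusion of the image of `Hⁿ(⊥ ≤ a)` in `Hⁿ(⊥ ≤ ⊤)`. -/
abbrev filtrationι (n : ℤ) (a : EInt) :
    X.opcycles (homOfLE (bot_le : ⊥ ≤ a)) (homOfLE (le_top : a ≤ ⊤)) n ⟶
      (X.H n).obj (mk₁ (homOfLE (bot_le : (⊥ : EInt) ≤ ⊤))) :=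
  X.fromOpcycles _ _ (homOfLE bot_le) rfl n

/-- The transition maps of the filtration of `Hⁿ(⊥ ≤ ⊤)`. -/
abbrev filtrationMap (n : ℤ) (a b : EInt) (hab : a ≤ b) :
    X.opcycles (homOfLE (bot_le : ⊥ ≤ a)) (homOfLE (le_top : a ≤ ⊤)) n ⟶
      X.opcycles (homOfLE (bot_le : ⊥ ≤ b)) (homOfLE (le_top : b ≤ ⊤)) n :=
  X.opcyclesMap _ _ _ _ (threeδ₂Toδ₁ (homOfLE bot_le) (homOfLE hab) (homOfLE le_top)
    (homOfLE bot_le) (homOfLE le_top) rfl rfl) n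

lemma filtrationMap_ι (n : ℤ) (a b : EInt) (hab : a ≤ b) :
    X.filtrationMap n a b hab ≫ X.filtrationι n b = X.filtrationι n a := by
  refine (X.opcyclesMap_fromOpcycles _ _ _ _ _ (by rfl) _ (by rfl) _ (𝟙 _) n (by rfl)
    (by rfl)).trans ?_
  simp

/-- The filtration of an object isomorphic to `Hⁿ(⊥ ≤ ⊤)`. -/
def filtration (n : ℤ) {H : C} (e : (X.H n).obj (mk₁ (homOfLE (bot_le : (⊥ : EInt) ≤ ⊤))) ≅ H)
    (a : EInt) : Subobject H :=
  Subobject.mk (X.filtrationι n a ≫ e.hom)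

lemma filtration_monotone (n : ℤ) {H : C}
    (e : (X.H n).obj (mk₁ (homOfLE (bot_le : (⊥ : EInt) ≤ ⊤))) ≅ H) :
    Monotone (X.filtration n e) := fun a b hab ↦
  Subobject.mk_le_mk_of_comm (X.filtrationMap n a b hab)
    (by rw [← Category.assoc, filtrationMap_ι])

lemma filtration_eq_top (n : ℤ) {H : C}
    (e : (X.H n).obj (mk₁ (homOfLE (bot_le : (⊥ : EInt) ≤ ⊤))) ≅ H) (a : EInt)
    (h : IsZero ((X.H n).obj (mk₁ (homOfLE (le_top : a ≤ ⊤))))) :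
    X.filtration n e a = ⊤ := by
  have : IsIso (X.filtrationι n a) := X.isIso_fromOpcycles _ _ _ rfl n h
  exact (Subobject.isIso_iff_mk_eq_top _).1 inferInstance

lemma filtration_eq_bot (n : ℤ) {H : C}
    (e : (X.H n).obj (mk₁ (homOfLE (bot_le : (⊥ : EInt) ≤ ⊤))) ≅ H) (a : EInt)
    (h : IsZero ((X.H n).obj (mk₁ (homOfLE (bot_le : ⊥ ≤ a))))) :
    X.filtration n e a = ⊥ := by
  refine Subobject.mk_eq_bot_iff_zero.2 ?_
  rw [← cancel_epi (X.pOpcycles ..)]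
  exact h.eq_of_src _ _

/-- The graded pieces of the filtration of `Hⁿ(⊥ ≤ ⊤)`. -/
def filtrationQuotientIso (n₀ n n₁ : ℤ) (h₀ : n₀ + 1 = n) (h₁ : n + 1 = n₁) {H : C}
    (e : (X.H n).obj (mk₁ (homOfLE (bot_le : (⊥ : EInt) ≤ ⊤))) ≅ H) (a b : EInt) (hab : a ≤ b)
    {S T : Subobject H} (hS : S = X.filtration n e a) (hT : T = X.filtration n e b) (h : S ≤ T) :
    cokernel (Subobject.ofLE S T h) ≅
      X.E (homOfLE (bot_le : ⊥ ≤ a)) (homOfLE hab) (homOfLE (le_top : b ≤ ⊤)) n₀ n n₁ h₀ h₁ :=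
  Subobject.cokernelOfLEIso (X.filtrationι n a ≫ e.hom) (X.filtrationι n b ≫ e.hom)
    (X.filtrationMap n a b hab) (by rw [← Category.assoc, filtrationMap_ι]) hS hT h ≪≫
    ((X.shortComplexOpcyclesThreeδ₂Toδ₁_shortExact (homOfLE bot_le) (homOfLE hab)
      (homOfLE le_top) (homOfLE bot_le) (homOfLE le_top) rfl rfl n₀ n n₁
      h₀ h₁).gIsCokernel.coconePointUniqueUpToIso
        (cokernelIsCokernel _)).symm

variable [X.IsFirstQuadrant]

/-- The objects of the `r`-th page of the spectral sequence for `r` large enough. -/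
lemma nonempty_iso_page (i j : ℕ) (r : ℤ) (hr : 2 ≤ r) (hi : (i : ℤ) < r) (hj : (j : ℤ) + 1 < r)
    (n₀ n n₁ : ℤ) (h₀ : n₀ + 1 = n) (h₁ : n + 1 = n₁) (hn : n = i + j) :
    Nonempty (X.E (homOfLE (bot_le : ⊥ ≤ ((j : ℤ) : EInt)))
      (homOfLE (show ((j : ℤ) : EInt) ≤ ((j + 1 : ℤ) : EInt) by simp))
      (homOfLE (le_top : ((j + 1 : ℤ) : EInt) ≤ ⊤)) n₀ n n₁ h₀ h₁ ≅
        (X.E₂SpectralSequenceNat.page r hr).X (i, j)) := by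
  have h₀₁ : ((j - r + 2 : ℤ) : EInt) ≤ ((j : ℤ) : EInt) := by simp; lia
  have h₁₂ : ((j : ℤ) : EInt) ≤ ((j + 1 : ℤ) : EInt) := by simp
  have h₂₃ : ((j + 1 : ℤ) : EInt) ≤ ((j + r - 1 : ℤ) : EInt) := by simp; lia
  -- The page object belongs to `j - r + 2 ≤ j ≤ j + 1 ≤ j + r - 1`. The lower end may be moved to
  -- `⊥` because `j + 1 < r` means `j - r + 2 ≤ 0`, the upper end to `⊤` because `i < r` means `n₀ <
  -- j + r - 1`.
  refine ⟨X.isoMapFourδ₁Toδ₀' ⊥ ((j - r + 2 : ℤ) : EInt) ((j : ℤ) : EInt) ((j + 1 : ℤ) : EInt) ⊤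
      bot_le h₀₁ h₁₂ le_top n₀ n n₁
      (X.isZero₁_of_isFirstQuadrant _ _ _ (by simp; lia) _) h₀ h₁ ≪≫
    (X.isoMapFourδ₄Toδ₃' _ _ _ ((j + r - 1 : ℤ) : EInt) ⊤ h₀₁ h₁₂ h₂₃ le_top n₀ n n₁
      (X.isZero₂_of_isFirstQuadrant _ _ _ _ (by simp; lia)) h₀ h₁).symm ≪≫
    (X.spectralSequencePageXIso coreE₂CohomologicalNat r hr (i, j) _ _ _ _ rfl rfl rfl rfl n₀ n n₁
      hn h₀ h₁).symm⟩

/-- The spectral sequence of a first quadrant spectral object converges to `Hⁿ(⊥ ≤ ⊤)`. -/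
theorem spectralConvergesTo (H : ℕ → C)
    (e : ∀ n : ℕ, (X.H n).obj (mk₁ (homOfLE (bot_le : (⊥ : EInt) ≤ ⊤))) ≅ H n) :
    SpectralConvergesTo X.E₂SpectralSequenceNat H := by
  intro n
  -- `Fⁱ` is the image of `Hⁿ(⊥ ≤ n + 1 - i)`: for `i = 0` and `i = n + 1` the vanishing of `Hⁿ(n +
  -- 1 ≤ ⊤)` and of `Hⁿ(⊥ ≤ 0)` gives `⊤` and `⊥`.
  refine ⟨fun i ↦ X.filtration n (e n) ((n + 1 - i : ℤ) : EInt),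
    fun i j hij ↦ X.filtration_monotone n (e n) (by simp; lia), ?_, ?_, ?_⟩
  · exact X.filtration_eq_top _ _ _ (X.isZero₂_of_isFirstQuadrant _ _ _ _ (by simp))
  · exact X.filtration_eq_bot _ _ _ (X.isZero₁_of_isFirstQuadrant _ _ _ (by simp) _)
  · intro i j hij r hr hi hj
    obtain ⟨f⟩ := X.nonempty_iso_page i j r hr hi hj (n - 1) n (n + 1) (by lia) rfl (by lia)
    have ha : (n + 1 - (i + 1 : ℕ) : ℤ) = j := by lia
    have hb : (n + 1 - i : ℤ) = j + 1 := by lia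
    exact ⟨X.filtrationQuotientIso (n - 1) n (n + 1) (by lia) rfl (e n) _ _ (by simp)
      (congrArg (fun k : ℤ ↦ X.filtration n (e n) (k : EInt)) ha)
      (congrArg (fun k : ℤ ↦ X.filtration n (e n) (k : EInt)) hb) _ ≪≫ f⟩

end CategoryTheory.Abelian.SpectralObject

/-! ### Hypercohomology through complexes of injectives -/

namespace CategoryTheory.Triangulated.SpectralObject

open Pretriangulated ComposableArrows

variable {C ι A : Type*} [Category* C] [Category* ι] [Category* A] [HasZeroObject C]
  [HasShift C ℤ] [Preadditive C] [∀ (n : ℤ), (shiftFunctor C n).Additive] [Pretriangulated C]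
  [Abelian A] (X : SpectralObject C ι) (F : C ⥤ A) [F.IsHomological] [F.ShiftSequence ℤ]

/-- The image of a spectral object in a triangulated category by a homological functor. -/
def mapHomologicalFunctor : Abelian.SpectralObject A ι where
  H n := X.ω₁ ⋙ F.shift n
  δ' n₀ n₁ h :=
    { app := fun D ↦ F.homologySequenceδ (X.ω₂.obj D) n₀ n₁ h
      naturality := fun _ _ φ ↦ (F.homologySequenceδ_naturality _ _ (X.ω₂.map φ) n₀ n₁ h) }
  exact₁' n₀ n₁ h D :=
    (F.homologySequence_exact₁ _ (X.ω₂_obj_distinguished D) n₀ n₁ h).exact_toComposableArrows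
  exact₂' n D :=
    (F.homologySequence_exact₂ _ (X.ω₂_obj_distinguished D) n).exact_toComposableArrows
  exact₃' n₀ n₁ h D :=
    (F.homologySequence_exact₃ _ (X.ω₂_obj_distinguished D) n₀ n₁ h).exact_toComposableArrows

end CategoryTheory.Triangulated.SpectralObject

namespace DerivedCategory.Plus

variable (C : Type*) [Category* C] [Abelian C] [HasDerivedCategory C] [EnoughInjectives C]

/-- The functor from the bounded below homotopy category of injective objects to the bounded below
derived category. -/
abbrev ofInjective : HomotopyCategory.Plus (InjectiveObject C) ⥤ DerivedCategory.Plus C :=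
  (InjectiveObject.ι C).mapHomotopyCategoryPlus ⋙ DerivedCategory.Plus.Qh

instance (X : HomotopyCategory.Plus (InjectiveObject C)) :
    CochainComplex.IsKInjective ((InjectiveObject.ι C).mapHomotopyCategoryPlus.obj X).obj.as := by
  obtain ⟨K, rfl⟩ := HomotopyCategory.Plus.quotient_obj_surjective X
  exact inferInstanceAs (CochainComplex.IsKInjective
      (((InjectiveObject.ι C).mapHomologicalComplex (.up ℤ)).obj K.obj))

/-- Bounded below complexes of injectives are K-injective, so homotopy classes of maps into them are
already the morphisms of the derived category. -/
lemma ofInjective_map_bijective (X Y : HomotopyCategory.Plus (InjectiveObject C)) :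
    Function.Bijective ((ofInjective C).map : (X ⟶ Y) → _) :=
  (Qh_map_bijective_of_isKInjective _ _ inferInstance).comp
    ((Functor.FullyFaithful.ofFullyFaithful
      (InjectiveObject.ι C).mapHomotopyCategoryPlus).map_bijective _ _)

instance : (ofInjective C).Full where
  map_surjective := (ofInjective_map_bijective C _ _).2

instance : (ofInjective C).Faithful where
  map_injective h := (ofInjective_map_bijective C _ _).1 h

instance : (ofInjective C).IsEquivalence where

instance : (ofInjective C).CommShift ℤ := inferInstance

instance : (ofInjective C).IsTriangulated := inferInstance

instance : (ofInjective C).asEquivalence.functor.CommShift ℤ :=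
  inferInstanceAs ((ofInjective C).CommShift ℤ)

instance : (ofInjective C).asEquivalence.inverse.CommShift ℤ :=
  (ofInjective C).asEquivalence.commShiftInverse ℤ

instance : (ofInjective C).asEquivalence.CommShift ℤ :=
  (ofInjective C).asEquivalence.commShift_of_functor ℤ

instance : (ofInjective C).asEquivalence.inverse.IsTriangulated :=
  (Equivalence.IsTriangulated.mk' (ofInjective C).asEquivalence
    (inferInstanceAs (ofInjective C).IsTriangulated)).rightAdjoint_isTriangulated

end DerivedCategory.Plus

namespace CategoryTheory.Functor

variable {C D : Type*} [Category* C] [Category* D] [Abelian C] [Abelian D]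
  [HasDerivedCategory C] [EnoughInjectives C] (F : C ⥤ D) [F.Additive]

/-- The degree `0` cohomology of the image under `F` of a bounded below complex of injectives. -/
abbrev cohomologyOfInjective : HomotopyCategory.Plus (InjectiveObject C) ⥤ D :=
  (InjectiveObject.ι C ⋙ F).mapHomotopyCategoryPlus ⋙ HomotopyCategory.Plus.ι D ⋙
    HomotopyCategory.homologyFunctor D (.up ℤ) 0

/-- The hypercohomology functor of `F`. -/
def hypercohomology : DerivedCategory.Plus C ⥤ D :=
  (DerivedCategory.Plus.ofInjective C).asEquivalence.inverse ⋙ F.cohomologyOfInjective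

instance : F.hypercohomology.IsHomological := by
  dsimp only [hypercohomology, cohomologyOfInjective]
  infer_instance

instance : F.hypercohomology.ShiftSequence ℤ := by
  dsimp only [hypercohomology, cohomologyOfInjective]
  infer_instance

/-- Hypercohomology is computed by bounded below complexes of injective objects. -/
def hypercohomologyIso (K : CochainComplex.Plus (InjectiveObject C)) (n : ℤ) :
    (F.hypercohomology.shift n).obj (DerivedCategory.Plus.Q.obj
      ((InjectiveObject.ι C).mapCochainComplexPlus.obj K)) ≅
    (((InjectiveObject.ι C ⋙ F).mapHomologicalComplex (.up ℤ)).obj K.obj).homology n := by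
  refine ((HomotopyCategory.Plus.ι D ⋙ HomotopyCategory.homologyFunctor D (.up ℤ) n).mapIso 
      ((InjectiveObject.ι C ⋙ F).mapHomotopyCategoryPlus.mapIso 
      ((DerivedCategory.Plus.ofInjective C).asEquivalence.unitIso.symm.app
        ((HomotopyCategory.Plus.quotient _).obj K)))) ≪≫ ?_
  exact (HomotopyCategory.homologyFunctorFactors D (.up ℤ) n).app
    (((InjectiveObject.ι C ⋙ F).mapHomologicalComplex (.up ℤ)).obj K.obj)

end CategoryTheory.Functor

namespace HomologicalComplex

variable {C D ι ι' : Type*} [Category* C] [Category* D] [HasZeroMorphisms C] [HasZeroMorphisms D]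
  [HasZeroObject C] [HasZeroObject D] {c : ComplexShape ι} {c' : ComplexShape ι'}
  (F : C ⥤ D) [F.PreservesZeroMorphisms] (K : HomologicalComplex C c)

/-- The compatibility of functors with the objects of extended complexes. -/
def extend.mapXIso : ∀ o : Option ι,
    F.obj (extend.X K o) ≅ extend.X ((F.mapHomologicalComplex c).obj K) o
  | some _ => Iso.refl _
  | none => (F.map_isZero (Limits.isZero_zero C)).iso (Limits.isZero_zero D)

lemma extend.mapXIso_hom_comm (o o' : Option ι) :
    (extend.mapXIso F K o).hom ≫ extend.d ((F.mapHomologicalComplex c).obj K) o o' =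
      F.map (extend.d K o o') ≫ (extend.mapXIso F K o').hom := by
  cases o with
  | none => exact (F.map_isZero (Limits.isZero_zero C)).eq_of_src _ _
  | some i =>
    cases o' with
    | none => exact (Limits.isZero_zero D).eq_of_tgt _ _
    | some j => exact (Category.id_comp _).trans (Category.comp_id _).symm

/-- Functors commute with the extension of complexes by zero. -/
def mapExtendIso (e : c.Embedding c') :
    (F.mapHomologicalComplex c').obj (K.extend e) ≅
      ((F.mapHomologicalComplex c).obj K).extend e :=
  Hom.isoOfComponents (fun i => extend.mapXIso F K (e.r i))
    (fun i j _ => extend.mapXIso_hom_comm F K (e.r i) (e.r j))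

end HomologicalComplex

namespace DerivedCategory.Plus

variable {C : Type*} [Category* C] [Abelian C] [HasDerivedCategory C]

lemma isIso_Q_map [EnoughInjectives C] {K L : CochainComplex.Plus C} (f : K ⟶ L)
    [hf : QuasiIso f.hom] : IsIso (Q.map f) :=
  Localization.inverts (HomotopyCategory.Plus.quotient C ⋙ Qh) (CochainComplex.Plus.quasiIso C)
    f hf

/-- `Q` sends a single complex to the corresponding single object. -/
def singleFunctorObjIso (M : C) (n : ℤ) :
    (singleFunctor C n).obj M ≅
      Q.obj ⟨(CochainComplex.singleFunctor C n).obj M, n, inferInstance⟩ :=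
  ι.preimageIso (((SingleFunctors.evaluation _ _ n).mapIso
    (singleFunctorsPostcompQIso C)).app M)

end DerivedCategory.Plus

namespace CategoryTheory.Functor

variable {C D : Type*} [Category* C] [Category* D] [Abelian C] [Abelian D]
  [HasDerivedCategory C] [EnoughInjectives C] (F : C ⥤ D) [F.Additive]

/-- Right derived functors are computed by injective resolutions, considered as complexes indexed
by the integers. -/
def homologyMapCochainComplexIso {M : C} (R : InjectiveResolution M) (n : ℕ) :
    ((F.mapHomologicalComplex (.up ℤ)).obj R.cochainComplex).homology (n : ℤ) ≅
      (F.rightDerived n).obj M :=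
  HomologicalComplex.homologyMapIso
    (HomologicalComplex.mapExtendIso F R.cocomplex ComplexShape.embeddingUpNat) n ≪≫
  HomologicalComplex.extendHomologyIso _ ComplexShape.embeddingUpNat (j := n) rfl ≪≫
  (R.isoRightDerivedObj F n).symm

/-- Hypercohomology is computed by bounded below complexes of injective objects. -/
def hypercohomologyIsoOfInjective (L : CochainComplex.Plus C) [hL : ∀ n, Injective (L.obj.X n)]
    (n : ℤ) : (F.hypercohomology.shift n).obj (DerivedCategory.Plus.Q.obj L) ≅
      ((F.mapHomologicalComplex (.up ℤ)).obj L.obj).homology n :=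
  F.hypercohomologyIso ⟨HomologicalComplex.liftObjectProperty _ L.obj hL, by
    obtain ⟨a, ha⟩ := L.property
    exact ⟨a, (CochainComplex.isStrictlyGE_mapHomologicalComplex_obj_iff _
      (InjectiveObject.ι _) _).1 ha⟩⟩ n

/-- The hypercohomology of an object in degree `0` is given by the right derived functors. -/
def hypercohomologySingleIso (M : C) (n : ℕ) :
    (F.hypercohomology.shift (n : ℤ)).obj ((DerivedCategory.Plus.singleFunctor C 0).obj M) ≅
      (F.rightDerived n).obj M :=
  let R := injectiveResolution M
  let L : CochainComplex.Plus C := ⟨R.cochainComplex, 0, inferInstance⟩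
  let f : (⟨(CochainComplex.singleFunctor C 0).obj M, 0, inferInstance⟩ :
    CochainComplex.Plus C) ⟶ L := ObjectProperty.homMk R.ι'
  haveI : QuasiIso f.hom := inferInstanceAs (QuasiIso R.ι')
  haveI := DerivedCategory.Plus.isIso_Q_map f
  haveI : ∀ n, Injective (L.obj.X n) := fun n => inferInstanceAs (Injective (R.cochainComplex.X n))
  (F.hypercohomology.shift (n : ℤ)).mapIso (DerivedCategory.Plus.singleFunctorObjIso M 0 ≪≫
    asIso (DerivedCategory.Plus.Q.map f)) ≪≫
  F.hypercohomologyIsoOfInjective L n ≪≫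
  F.homologyMapCochainComplexIso R n

lemma isZero_hypercohomology_of_isGE (X : DerivedCategory.Plus C) (a n : ℤ) [X.IsGE a]
    (h : n < a) : IsZero ((F.hypercohomology.shift n).obj X) := by
  obtain ⟨L, hL, ⟨e⟩⟩ := DerivedCategory.Plus.exists_injective_nonempty_iso X a
  refine IsZero.of_iso ?_ ((F.hypercohomology.shift n).mapIso e.symm ≪≫ F.hypercohomologyIso L n)
  exact CochainComplex.isZero_of_isGE
    (((InjectiveObject.ι C ⋙ F).mapHomologicalComplex (.up ℤ)).obj L.obj) a n h

end CategoryTheory.Functor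

namespace DerivedCategory.Plus

open Pretriangulated

variable {C : Type*} [Category* C] [Abelian C] [HasDerivedCategory C]

/-- Complete the first map to a triangle in the bounded below category, then compare it in the full
derived category with the triangle of the short exact sequence. This is the source of the long exact
sequence of derived functors. -/
lemma exists_distinguished_of_shortExact {S : ShortComplex C} (hS : S.ShortExact) :
    ∃ (Z : Plus C) (g : (singleFunctor C 0).obj S.X₂ ⟶ Z)
      (δ : Z ⟶ ((singleFunctor C 0).obj S.X₁)⟦(1 : ℤ)⟧)
      (_ : Nonempty (Z ≅ (singleFunctor C 0).obj S.X₃)),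
        Triangle.mk ((singleFunctor C 0).map S.f) g δ ∈ distTriang (Plus C) := by
  obtain ⟨Z, g, δ, h⟩ := distinguished_cocone_triangle ((singleFunctor C 0).map S.f)
  refine ⟨Z, g, δ, ⟨ι.preimageIso ?_⟩, h⟩
  exact Triangle.π₃.mapIso (isoTriangleOfIso₁₂ (ι.mapTriangle.obj (Triangle.mk _ g δ))
    hS.singleTriangle (ι.map_distinguished _ h) hS.singleTriangle_distinguished
    (Iso.refl _) (Iso.refl _) ((Category.comp_id _).trans (Category.id_comp _).symm))

end DerivedCategory.Plus

/-! ### Acyclic objects compute hypercohomology -/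

namespace CategoryTheory.ShortComplex.ShortExact

variable {C : Type*} [Category* C] [Abelian C]

/-- `S.g` is epi, and `S.g` and `d` have the same kernel `S.X₁`. The gain is that a left exact
functor preserves this square. -/
lemma isPullback {S : ShortComplex C} (hS : S.ShortExact) {I Z : C} (a : S.X₂ ⟶ I) (d : I ⟶ Z)
    (b : S.X₃ ⟶ Z) (comm : a ≫ d = S.g ≫ b) [Mono (S.f ≫ a)]
    (hd : (ShortComplex.mk (S.f ≫ a) d (by simp [comm])).Exact) : IsPullback a S.g d b := by
  have := hS.epi_g
  have h₁ := pullback.lift_fst a S.g comm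
  have h₂ := pullback.lift_snd a S.g comm
  have hmono : Mono (pullback.lift a S.g comm) := by
    rw [Preadditive.mono_iff_cancel_zero]
    intro T z hz
    have hz₁ : z ≫ a = 0 := by rw [← h₁, reassoc_of% hz, zero_comp]
    have hz₂ : z ≫ S.g = 0 := by rw [← h₂, reassoc_of% hz, zero_comp]
    have := hS.mono_f
    rw [← hS.exact.lift_f z hz₂, Category.assoc] at hz₁
    rw [← hS.exact.lift_f z hz₂,
      (Preadditive.mono_iff_cancel_zero (S.f ≫ a)).1 inferInstance _ _ hz₁, zero_comp]
  have hepi : Epi (pullback.lift a S.g comm) := by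
    rw [epi_iff_surjective_up_to_refinements]
    intro T t
    obtain ⟨T₁, π₁, _, x, hx⟩ := surjective_up_to_refinements_of_epi S.g (t ≫ pullback.snd d b)
    obtain ⟨T₂, π₂, _, y, hy⟩ := hd.exact_up_to_refinements (π₁ ≫ t ≫ pullback.fst d b - x ≫ a) (by
      simp [comm, ← reassoc_of% hx, pullback.condition])
    refine ⟨T₂, π₂ ≫ π₁, epi_comp _ _, y ≫ S.f + π₂ ≫ x, ?_⟩
    dsimp at hy
    apply pullback.hom_ext
    · simp [h₁, ← hy]
    · simp [h₂, ← hx]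
  have : IsIso (pullback.lift a S.g comm) := isIso_of_mono_of_epi _
  exact IsPullback.of_iso_pullback ⟨comm⟩ (asIso (pullback.lift a S.g comm)) h₁ h₂

end CategoryTheory.ShortComplex.ShortExact

namespace CategoryTheory.Functor

variable {C D : Type*} [Category* C] [Category* D] [Abelian C] [Abelian D]
  [EnoughInjectives C] (F : C ⥤ D) [F.Additive]

instance (n : ℕ) : (F.rightDerived n).Additive where
  map_add {X Y f g} := by
    let P := injectiveResolution X
    let Q := injectiveResolution Y
    let φ (h : X ⟶ Y) := InjectiveResolution.desc h Q P
    have hφ (h : X ⟶ Y) : P.ι ≫ φ h = (CochainComplex.single₀ C).map h ≫ Q.ι :=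
      InjectiveResolution.desc_commutes h Q P
    rw [F.rightDerived_map_eq n f (φ f) (hφ f), F.rightDerived_map_eq n g (φ g) (hφ g),
      F.rightDerived_map_eq n (f + g) (φ f + φ g) (by
        rw [Preadditive.comp_add, hφ, hφ, Functor.map_add, Preadditive.add_comp])]
    simp only [Functor.map_add, Preadditive.comp_add, Preadditive.add_comp]

/-- An object is acyclic for `F` if the higher right derived functors of `F` vanish on it. -/
def IsRightAcyclic (X : C) : Prop := ∀ n : ℕ, IsZero ((F.rightDerived (n + 1)).obj X)

variable {F} in
lemma IsRightAcyclic.of_iso {X Y : C} (h : F.IsRightAcyclic X) (e : X ≅ Y) :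
    F.IsRightAcyclic Y :=
  fun n => (h n).of_iso ((F.rightDerived _).mapIso e.symm)

lemma isRightAcyclic_of_injective (X : C) [Injective X] : F.IsRightAcyclic X :=
  fun n => F.isZero_rightDerived_obj_injective_succ n X

variable {F} in
lemma IsRightAcyclic.biprod {X Y : C} (hX : F.IsRightAcyclic X) (hY : F.IsRightAcyclic Y) :
    F.IsRightAcyclic (X ⊞ Y) :=
  fun n =>
  haveI := preservesBinaryBiproducts_of_preservesBiproducts (F.rightDerived (n + 1))
  IsZero.of_iso (biprod_isZero_iff _ _ |>.2 ⟨hX n, hY n⟩)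
    ((F.rightDerived (n + 1)).mapBiprod X Y)

lemma isZero_rightDerived_X₃ [HasDerivedCategory C] {S : ShortComplex C} (hS : S.ShortExact) (n : ℕ)
    (h₂ : IsZero ((F.rightDerived n).obj S.X₂)) (h₁ : IsZero ((F.rightDerived (n + 1)).obj S.X₁)) :
    IsZero ((F.rightDerived n).obj S.X₃) := by
  obtain ⟨Z, g, δ, ⟨e⟩, h⟩ := DerivedCategory.Plus.exists_distinguished_of_shortExact hS
  refine IsZero.of_iso ?_ ((F.hypercohomologySingleIso S.X₃ n).symm ≪≫
    (F.hypercohomology.shift (n : ℤ)).mapIso e.symm)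
  exact (F.hypercohomology.homologySequence_exact₃ _ h n (n + 1 : ℕ) (by simp)).isZero_of_both_zeros
    ((h₂.of_iso (F.hypercohomologySingleIso S.X₂ n)).eq_of_src _ _)
    ((h₁.of_iso (F.hypercohomologySingleIso S.X₁ (n + 1))).eq_of_tgt _ _)

lemma IsRightAcyclic.X₃ [HasDerivedCategory C] {S : ShortComplex C} (hS : S.ShortExact)
    (h₁ : F.IsRightAcyclic S.X₁) (h₂ : F.IsRightAcyclic S.X₂) : F.IsRightAcyclic S.X₃ :=
  fun n => F.isZero_rightDerived_X₃ hS _ (h₂ n) (h₁ (n + 1))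

/-- With `I` an injective resolution of `S.X₁`, `S.X₂` is the pullback of `I⁰ ⟶ I¹ ⟵ S.X₃`, and `F`
keeps it so. An element of `F(S.X₃)` gives a cocycle in `F(I¹)`; it comes from `F(I⁰)` since
`R¹F(S.X₁) = 0`, and the pullback yields a preimage. -/
lemma epi_map_g_of_isZero_rightDerived [PreservesFiniteLimits F] {S : ShortComplex C}
    (hS : S.ShortExact)
    (h₁ : IsZero ((F.rightDerived 1).obj S.X₁)) : Epi (F.map S.g) := by
  let R := injectiveResolution S.X₁
  have := hS.mono_f
  have := hS.epi_g
  let j : S.X₁ ⟶ R.cocomplex.X 0 := R.ι.f 0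
  have hj : j ≫ R.cocomplex.d 0 1 = 0 := R.ι_f_zero_comp_complex_d
  have hj' : (ShortComplex.mk j _ hj).Exact := R.exact₀
  have : Mono j := inferInstanceAs (Mono (R.ι.f 0))
  let a : S.X₂ ⟶ R.cocomplex.X 0 := Injective.factorThru j S.f
  have ha : S.f ≫ a = j := Injective.comp_factorThru _ _
  let b : S.X₃ ⟶ R.cocomplex.X 1 := hS.exact.desc (a ≫ R.cocomplex.d 0 1) (by
    rw [reassoc_of% ha, hj])
  have hb : S.g ≫ b = a ≫ R.cocomplex.d 0 1 := hS.exact.g_desc _ _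
  have hb' : b ≫ R.cocomplex.d 1 2 = 0 := by
    rw [← cancel_epi S.g, reassoc_of% hb]
    simp
  have hFb : F.map b ≫ F.map (R.cocomplex.d 1 2) = 0 := by rw [← F.map_comp, hb', F.map_zero]
  have : Mono (S.f ≫ a) := by rwa [ha]
  have sq := (hS.isPullback a _ b hb.symm (by simpa only [ha] using hj')).map F
  have hex : ((F.mapHomologicalComplex (.up ℕ)).obj R.cocomplex).ExactAt 1 := by
    rw [HomologicalComplex.exactAt_iff_isZero_homology]
    exact h₁.of_iso (R.isoRightDerivedObj F 1).symm
  rw [HomologicalComplex.exactAt_iff' _ 0 1 2 (by simp) (by simp)] at hex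
  rw [epi_iff_surjective_up_to_refinements]
  intro T y
  obtain ⟨T', π, _, x, hx⟩ := hex.exact_up_to_refinements (y ≫ F.map b) 
    ((Category.assoc _ _ _).trans ((congrArg (y ≫ ·) hFb).trans comp_zero))
  exact ⟨T', π, inferInstance, sq.lift x (π ≫ y) (hx.symm.trans (Category.assoc _ _ _).symm),
    (sq.lift_snd _ _ _).symm⟩

end CategoryTheory.Functor

namespace HomologicalComplex

variable {C : Type*} [Category* C] [Abelian C]

lemma shortExact_iCycles_toCycles {ι : Type*} {c : ComplexShape ι} (K : HomologicalComplex C c)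
    (i j : ι) (hij : c.Rel i j) (hK : K.ExactAt j) :
    (ShortComplex.mk (K.iCycles i) (K.toCycles i j) (by
      rw [← cancel_mono (K.iCycles j)]; simp)).ShortExact where
  exact := by
    have key {A : C} (x : A ⟶ K.X i) (hx : x ≫ K.toCycles i j = 0) : x ≫ K.d i j = 0 := by
      rw [← K.toCycles_i i j, reassoc_of% hx, zero_comp]
    have h := ShortComplex.exact_of_f_is_kernel (ShortComplex.mk (K.iCycles i) (K.d i j) (by simp))
      (K.cyclesIsKernel i j (c.next_eq' hij))
    rw [ShortComplex.exact_iff_exact_up_to_refinements] at h ⊢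
    intro A x hx
    exact h x (key x hx)
  mono_f := inferInstanceAs (Mono (K.iCycles i))
  epi_g := by
    rw [HomologicalComplex.ExactAt, ShortComplex.exact_iff_epi_toCycles] at hK
    obtain rfl := c.prev_eq' hij
    exact hK

end HomologicalComplex

namespace CochainComplex

variable {C : Type*} [Category* C] [Abelian C]

lemma quasiIso_iff_acyclic_mappingCone {K L : CochainComplex C ℤ} (f : K ⟶ L) :
    QuasiIso f ↔ (mappingCone f).Acyclic := by
  rw [← HomotopyCategory.quotient_obj_mem_subcategoryAcyclic_iff_acyclic,
    ← HomologicalComplex.mem_quasiIso_iff, ← HomotopyCategory.quotient_map_mem_quasiIso_iff,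
    HomotopyCategory.quasiIso_eq_trW_subcategoryAcyclic]
  exact ObjectProperty.trW_iff_of_distinguished _ _
    (HomotopyCategory.mappingCone_triangleh_distinguished f)

end CochainComplex

namespace CategoryTheory.Functor

variable {C D : Type*} [Category* C] [Category* D] [Abelian C] [Abelian D]
  [HasDerivedCategory C] [EnoughInjectives C] (F : C ⥤ D) [F.Additive]

/-- Upward induction: cycles vanish below `a`, and each later one is the quotient of an acyclic term
by the preceding cycles, hence acyclic by the long exact sequence. -/
lemma isRightAcyclic_cycles (K : CochainComplex C ℤ) (a : ℤ) [K.IsStrictlyGE a]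
    (hK : K.Acyclic) (h : ∀ n, F.IsRightAcyclic (K.X n)) (n : ℤ) :
    F.IsRightAcyclic (K.cycles n) := by
  have h₀ (n : ℤ) (hn : n < a) : F.IsRightAcyclic (K.cycles n) := by
    have : IsZero (K.cycles n) :=
      (K.isZero_of_isStrictlyGE a n hn).of_mono (K.iCycles n)
    exact fun i => (F.rightDerived (i + 1)).map_isZero this
  have h₁ (k : ℕ) : F.IsRightAcyclic (K.cycles (a - 1 + k)) := by
    induction k with
    | zero => exact h₀ _ (by simp)
    | succ k hk =>
      exact IsRightAcyclic.X₃ F (K.shortExact_iCycles_toCycles (a - 1 + k) (a - 1 + (k + 1 : ℕ))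
        (by simp; lia) (hK _)) hk (h _)
  by_cases hn : n < a
  · exact h₀ n hn
  · obtain ⟨k, hk⟩ := Int.le.dest (show a - 1 ≤ n by lia)
    exact hk ▸ h₁ k

/-- By left exactness the kernel of `F(d)` is `F` of the cycles, and the preceding term maps onto it
because `R¹F` vanishes on the cycles one degree lower. -/
lemma acyclic_mapHomologicalComplex_obj [PreservesFiniteLimits F] (K : CochainComplex C ℤ) (a : ℤ)
    [K.IsStrictlyGE a] (hK : K.Acyclic) (h : ∀ n, F.IsRightAcyclic (K.X n)) :
    ((F.mapHomologicalComplex (.up ℤ)).obj K).Acyclic := by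
  intro n
  obtain ⟨m, rfl⟩ : ∃ m, n = m + 1 := ⟨n - 1, by simp⟩
  rw [HomologicalComplex.exactAt_iff' _ m (m + 1) (m + 1 + 1) (by simp) (by simp),
    ShortComplex.exact_iff_exact_up_to_refinements]
  have hepi : Epi (F.map (K.toCycles m (m + 1))) :=
    F.epi_map_g_of_isZero_rightDerived (K.shortExact_iCycles_toCycles m (m + 1) (by simp) (hK _))
      (F.isRightAcyclic_cycles K a hK h m 0)
  intro A x hx
  have hl := isLimitForkMapOfIsLimit' F _ (K.cyclesIsKernel (m + 1) (m + 1 + 1) (by simp))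
  obtain ⟨y, hy⟩ := KernelFork.IsLimit.lift' hl x hx
  obtain ⟨A', π, hπ, z, hz⟩ := surjective_up_to_refinements_of_epi (F.map (K.toCycles m (m + 1))) y
  refine ⟨A', π, hπ, z, ?_⟩
  have : F.map (K.toCycles m (m + 1)) ≫ F.map (K.iCycles (m + 1)) = F.map (K.d m (m + 1)) := by
    rw [← F.map_comp, K.toCycles_i]
  refine (congrArg (π ≫ ·) hy.symm).trans ?_
  refine ((Category.assoc _ _ _).symm.trans ?_).trans (congrArg (z ≫ ·) this)
  exact (congrArg (· ≫ F.map (K.iCycles (m + 1))) hz).trans (Category.assoc _ _ _)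

/-- Hypercohomology is computed by bounded below complexes of acyclic objects. -/
lemma nonempty_hypercohomology_iso [PreservesFiniteLimits F] (K : CochainComplex.Plus C)
    (h : ∀ n, F.IsRightAcyclic (K.obj.X n)) (n : ℤ) :
    Nonempty ((F.hypercohomology.shift n).obj (DerivedCategory.Plus.Q.obj K) ≅
      ((F.mapHomologicalComplex (.up ℤ)).obj K.obj).homology n) := by
  obtain ⟨a, ha⟩ := K.property
  obtain ⟨L, hL, i, hi⟩ := CochainComplex.Plus.exists_quasiIso_injective K a
  have hi' : QuasiIso i.hom := hi
  have := DerivedCategory.Plus.isIso_Q_map i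
  have hL' : ((InjectiveObject.ι C).mapCochainComplexPlus.obj L).obj.IsStrictlyGE a :=
    inferInstanceAs (CochainComplex.IsStrictlyGE
      (((InjectiveObject.ι C).mapHomologicalComplex (.up ℤ)).obj L.obj) a)
  have := CochainComplex.isStrictlyGE_mappingCone i.hom a a (a - 1)
  -- In degree `n` the cone is `Kⁿ⁺¹ ⊞ Lⁿ`, hence acyclic for `F`, and the cone starts in degree `a
  -- - 1`. As `F` commutes with cones, `F(K) ⟶ F(L)` is a quasi-isomorphism.
  have hcone := F.acyclic_mapHomologicalComplex_obj (CochainComplex.mappingCone i.hom) (a - 1)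
    ((CochainComplex.quasiIso_iff_acyclic_mappingCone _).1 hi') (fun n =>
      ((h (n + 1)).biprod (@isRightAcyclic_of_injective _ _ _ _ _ _ _ F _
        (((InjectiveObject.ι C).mapCochainComplexPlus.obj L).obj.X n)
        (inferInstanceAs (Injective (L.obj.X n).obj)))).of_iso
        (HomologicalComplex.homotopyCofiber.XIsoBiprod i.hom n (n + 1) rfl).symm)
  have hF : QuasiIso ((F.mapHomologicalComplex (.up ℤ)).map i.hom) := by
    rw [CochainComplex.quasiIso_iff_acyclic_mappingCone]
    exact fun n => (hcone n).of_iso (CochainComplex.mappingCone.mapHomologicalComplexIso i.hom F)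
  exact ⟨(F.hypercohomology.shift n).mapIso (asIso (DerivedCategory.Plus.Q.map i)) ≪≫
    F.hypercohomologyIso L n ≪≫
    (asIso (HomologicalComplex.homologyMap ((F.mapHomologicalComplex (.up ℤ)).map i.hom) n)).symm⟩

end CategoryTheory.Functor

/-! ### Truncations and the hypercohomology spectral sequence -/

namespace DerivedCategory.Plus

open Pretriangulated DerivedCategory.Plus.TStructure

variable {C : Type*} [Category* C] [Abelian C] [HasDerivedCategory C]

lemma isIso_homologyFunctor_map_mor₁ (T : Triangle (Plus C)) (hT : T ∈ distTriang (Plus C))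
    (n m : ℤ) [T.obj₃.IsGE m] (h : n < m) : IsIso ((homologyFunctor C n).map T.mor₁) := by
  have hT' := Plus.ι.map_distinguished T hT
  have : Mono ((homologyFunctor C n).map T.mor₁) :=
    (DerivedCategory.HomologySequence.exact₁ _ hT' (n - 1) n).mono_g
      ((isZero_homology_of_isGE T.obj₃ m (n - 1) (by lia)).eq_of_src _ _)
  have : Epi ((homologyFunctor C n).map T.mor₁) :=
    (DerivedCategory.HomologySequence.exact₂ _ hT' n).epi_f
      ((isZero_homology_of_isGE T.obj₃ m n (by lia)).eq_of_tgt _ _)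
  exact isIso_of_mono_of_epi _

lemma isIso_homologyFunctor_map_mor₂ (T : Triangle (Plus C)) (hT : T ∈ distTriang (Plus C))
    (n m : ℤ) [T.obj₁.IsLE m] (h : m < n) : IsIso ((homologyFunctor C n).map T.mor₂) := by
  have hT' := Plus.ι.map_distinguished T hT
  have : Mono ((homologyFunctor C n).map T.mor₂) :=
    (DerivedCategory.HomologySequence.exact₂ _ hT' n).mono_g
      ((isZero_homology_of_isLE T.obj₁ m n (by lia)).eq_of_src _ _)
  have : Epi ((homologyFunctor C n).map T.mor₂) :=
    (DerivedCategory.HomologySequence.exact₃ _ hT' n (n + 1)).epi_f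
      ((isZero_homology_of_isLE T.obj₁ m (n + 1) (by lia)).eq_of_tgt _ _)
  exact isIso_of_mono_of_epi _

lemma nonempty_iso_singleFunctor_obj (X : Plus C) (n : ℤ) [X.IsGE n] [X.IsLE n] :
    Nonempty (X ≅ (singleFunctor C n).obj ((homologyFunctor C n).obj X)) := by
  obtain ⟨Y, ⟨e⟩⟩ := DerivedCategory.exists_iso_singleFunctor_obj_of_isGE_of_isLE (ι.obj X) n
  let e' : (homologyFunctor C n).obj X ≅ Y := (DerivedCategory.homologyFunctor C n).mapIso e ≪≫
    (DerivedCategory.singleFunctorCompHomologyFunctorIso C n).app Y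
  exact ⟨ι.preimageIso (e ≪≫ (DerivedCategory.singleFunctor C n).mapIso e'.symm)⟩

/-- The double truncation is concentrated in degree `n`, and neither truncation triangle changes the
cohomology in that degree. -/
lemma nonempty_truncGE_obj_truncLT_obj_iso (X : Plus C) (n : ℤ) :
    Nonempty ((t.truncGE n).obj ((t.truncLT (n + 1)).obj X) ≅
      (singleFunctor C n).obj ((homologyFunctor C n).obj X)) := by
  have hGE : ((t.truncGE (n + 1)).obj X).IsGE (n + 1) := inferInstance
  have h₁ := @isIso_homologyFunctor_map_mor₁ _ _ _ _ _
    (t.triangleLTGE_distinguished (n + 1) X) n (n + 1) hGE (by lia)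
  have hLE : ((t.truncLT n).obj ((t.truncLT (n + 1)).obj X)).IsLE (n - 1) :=
    t.isLE_truncLT_obj ..
  have h₂ := @isIso_homologyFunctor_map_mor₂ _ _ _ _ _
    (t.triangleLTGE_distinguished n ((t.truncLT (n + 1)).obj X)) n (n - 1) hLE (by lia)
  have h₃ : ((t.truncLT (n + 1)).obj X).IsLE n := t.isLE_truncLT_obj ..
  have h₄ : ((t.truncGE n).obj ((t.truncLT (n + 1)).obj X)).IsLE n := inferInstance
  have h₅ : ((t.truncGE n).obj ((t.truncLT (n + 1)).obj X)).IsGE n := inferInstance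
  obtain ⟨e⟩ := nonempty_iso_singleFunctor_obj ((t.truncGE n).obj ((t.truncLT (n + 1)).obj X)) n
  exact ⟨e ≪≫ (singleFunctor C n).mapIso ((@asIso _ _ _ _ _ h₂).symm ≪≫ @asIso _ _ _ _ _ h₁)⟩

instance isGE_Q_obj (K : CochainComplex.Plus C) (n : ℤ) [K.obj.IsStrictlyGE n] :
    (Q.obj K).IsGE n := by
  rw [← isGE_ι_obj_iff]
  exact DerivedCategory.TStructure.t.isGE_of_iso ((quotientCompQhIso C).symm.app K.obj) n

/-- The homology of the image in the derived category of a bounded below complex. -/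
def homologyFunctorObjQObjIso (K : CochainComplex.Plus C) (n : ℤ) :
    (homologyFunctor C n).obj (Q.obj K) ≅ K.obj.homology n :=
  (DerivedCategory.homologyFunctor C n).mapIso ((quotientCompQhIso C).app K.obj) ≪≫
    (DerivedCategory.homologyFunctorFactors C n).app K.obj

end DerivedCategory.Plus

namespace CategoryTheory.Functor

open DerivedCategory.Plus.TStructure ComposableArrows

variable {C D : Type*} [Category* C] [Category* D] [Abelian C] [Abelian D]
  [HasDerivedCategory C] [EnoughInjectives C] (F : C ⥤ D) [F.Additive]

lemma nonempty_hypercohomology_singleFunctor_iso (M : C) (p q : ℕ) :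
    Nonempty ((F.hypercohomology.shift ((p : ℤ) + q)).obj
      ((DerivedCategory.Plus.singleFunctor C q).obj M) ≅ (F.rightDerived p).obj M) :=
  ⟨((F.hypercohomology.shiftIso (q : ℤ) p (p + q) (add_comm _ _)).app _).symm ≪≫
    (F.hypercohomology.shift (p : ℤ)).mapIso
      (((DerivedCategory.Plus.singleFunctors C).shiftIso q 0 q (by simp)).app M) ≪≫
    F.hypercohomologySingleIso M p⟩

/-- The spectral object giving the second hypercohomology spectral sequence. -/
abbrev hypercohomologySpectralObject (X : DerivedCategory.Plus C) :
    Abelian.SpectralObject D EInt :=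
  (t.spectralObject X).mapHomologicalFunctor F.hypercohomology

/-- For `j ≤ 0` the truncation of `X` below `j` is zero; for `n < i` the piece lies in degrees at
least `n + 1`. -/
instance (X : DerivedCategory.Plus C) [X.IsGE 0] :
    (F.hypercohomologySpectralObject X).IsFirstQuadrant where
  isZero₁ i j hij hj n := by
    have h : IsZero ((t.eTruncGE.obj i).obj ((t.eTruncLT.obj j).obj X)) :=
      (t.eTruncGE.obj i).map_isZero (t.isZero_eTruncLT_obj_obj X 0 j hj)
    have := t.isGE_of_isZero h (n + 1)
    exact F.isZero_hypercohomology_of_isGE ((t.eTruncGE.obj i).obj ((t.eTruncLT.obj j).obj X))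
      (n + 1) n (by lia)
  isZero₂ i j hij n hn := by
    have := t.isGE_eTruncGE_obj_obj (n + 1) i
      (by
        induction i using WithBotTop.rec with
        | bot => simp at hn
        | coe i => simpa using hn
        | top => simp) ((t.eTruncLT.obj j).obj X)
    exact F.isZero_hypercohomology_of_isGE ((t.eTruncGE.obj i).obj ((t.eTruncLT.obj j).obj X))
      (n + 1) n (by lia)

lemma nonempty_hypercohomologySpectralObject_page_two_iso (X : DerivedCategory.Plus C) [X.IsGE 0]
    (hr : (2 : ℤ) ≤ 2) (p q : ℕ) :
    Nonempty (((F.hypercohomologySpectralObject X).E₂SpectralSequenceNat.page 2 hr).X (p, q) ≅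
      (F.rightDerived p).obj ((DerivedCategory.Plus.homologyFunctor C q).obj X)) := by
  obtain ⟨e⟩ := DerivedCategory.Plus.nonempty_truncGE_obj_truncLT_obj_iso X q
  obtain ⟨e'⟩ := F.nonempty_hypercohomology_singleFunctor_iso
    ((DerivedCategory.Plus.homologyFunctor C q).obj X) p q
  let e₁ : ((F.hypercohomologySpectralObject X).E₂SpectralSequenceNat.page 2 hr).X (p, q) ≅
      (F.hypercohomology.shift ((p : ℤ) + q)).obj
        ((t.truncGE q).obj ((t.truncLT (q + 1)).obj X)) :=
    (F.hypercohomologySpectralObject X).spectralSequenceFirstPageXIso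
      Abelian.SpectralObject.coreE₂CohomologicalNat (p, q) (q : ℤ) ((q + 1 : ℤ) :) rfl rfl
      ((p : ℤ) + q) rfl
  exact ⟨e₁ ≪≫ (F.hypercohomology.shift _).mapIso e ≪≫ e'⟩

end CategoryTheory.Functor

/-! ### The Grothendieck spectral sequence and composites of derived functors -/

namespace CategoryTheory

/-- The Grothendieck spectral sequence of a composition of functors. -/
theorem exists_grothendieckSpectralSequence {C D E : Type*} [Category* C] [Category* D]
    [Category* E] [Abelian C] [Abelian D] [Abelian E] [EnoughInjectives C] [EnoughInjectives D]
    (S : C ⥤ D) (F : D ⥤ E) [S.Additive] [F.Additive] [PreservesFiniteLimits F]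
    (hS : ∀ I : C, Injective I → F.IsRightAcyclic (S.obj I)) (V : C) :
    ∃ 𝓔 : E₂CohomologicalSpectralSequenceNat E,
      (∀ (hr : (2 : ℤ) ≤ 2) (i j : ℕ), Nonempty ((𝓔.page 2 hr).X (i, j) ≅
        (F.rightDerived i).obj ((S.rightDerived j).obj V))) ∧
      ∀ H : ℕ → E, (∀ n, Nonempty (((S ⋙ F).rightDerived n).obj V ≅ H n)) →
        SpectralConvergesTo 𝓔 H := by
  let _ := HasDerivedCategory.standard D
  let R := injectiveResolution V
  have hL : CochainComplex.IsStrictlyGE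
      ((S.mapHomologicalComplex (.up ℤ)).obj R.cochainComplex) 0 := inferInstance
  let L : CochainComplex.Plus D := ⟨(S.mapHomologicalComplex (.up ℤ)).obj R.cochainComplex, 0, hL⟩
  have : L.obj.IsStrictlyGE 0 := hL
  let X := DerivedCategory.Plus.Q.obj L
  refine ⟨(F.hypercohomologySpectralObject X).E₂SpectralSequenceNat, fun hr i j => ?_,
    fun H hH => ?_⟩
  · obtain ⟨e⟩ := F.nonempty_hypercohomologySpectralObject_page_two_iso X hr i j
    exact ⟨e ≪≫ (F.rightDerived i).mapIso (DerivedCategory.Plus.homologyFunctorObjQObjIso L j ≪≫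
      S.homologyMapCochainComplexIso R j)⟩
  · refine (F.hypercohomologySpectralObject X).spectralConvergesTo H (fun n => ?_)
    have e := F.nonempty_hypercohomology_iso L
      (fun m => hS (R.cochainComplex.X m) inferInstance) n
    exact e.some ≪≫ (S ⋙ F).homologyMapCochainComplexIso R n ≪≫ (hH n).some

end CategoryTheory

namespace CategoryTheory.Functor

section

variable {C D E : Type*} [Category* C] [Category* D] [Category* E] [Abelian C] [Abelian D]
  [Abelian E]

lemma isRightAcyclic_of_preservesHomology [EnoughInjectives C] (F : C ⥤ D) [F.Additive]
    [F.PreservesHomology] (X : C) : F.IsRightAcyclic X := by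
  intro n
  let R := injectiveResolution X
  refine IsZero.of_iso ?_ (R.isoRightDerivedObj F (n + 1))
  refine IsZero.of_iso (F.map_isZero ?_) ((R.cocomplex.sc (n + 1)).mapHomologyIso F)
  exact (R.cocomplex_exactAt_succ n).isZero_homology

lemma nonempty_rightDerived_iso [EnoughInjectives C] {F G : C ⥤ D} [F.Additive] [G.Additive]
    (e : F ≅ G) (n : ℕ) (X : C) :
    Nonempty ((F.rightDerived n).obj X ≅ (G.rightDerived n).obj X) := by
  let e' : F.rightDerived n ≅ G.rightDerived n :=
    { hom := NatTrans.rightDerived e.hom n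
      inv := NatTrans.rightDerived e.inv n
      hom_inv_id := by rw [← NatTrans.rightDerived_comp]; simp
      inv_hom_id := by rw [← NatTrans.rightDerived_comp]; simp }
  exact ⟨e'.app X⟩

/-- The image under `G` of an injective resolution of `X` consists of injectives and has cohomology
only in degree `0`, where it is `G(X)`. Its hypercohomology for `F` can therefore be read in both
ways. -/
lemma nonempty_rightDerived_comp_iso [EnoughInjectives C] [EnoughInjectives D] (G : C ⥤ D)
    (F : D ⥤ E) [G.Additive] [F.Additive] [PreservesFiniteLimits G]
    (hG : ∀ I : C, Injective I → Injective (G.obj I)) (X : C) (hX : G.IsRightAcyclic X) (n : ℕ) :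
    Nonempty (((G ⋙ F).rightDerived n).obj X ≅ (F.rightDerived n).obj (G.obj X)) := by
  let _ := HasDerivedCategory.standard D
  let R := injectiveResolution X
  have hL : CochainComplex.IsStrictlyGE
      ((G.mapHomologicalComplex (.up ℤ)).obj R.cochainComplex) 0 := inferInstance
  let L : CochainComplex.Plus D := ⟨(G.mapHomologicalComplex (.up ℤ)).obj R.cochainComplex, 0, hL⟩
  have : L.obj.IsStrictlyGE 0 := hL
  have : ∀ m, Injective (L.obj.X m) := fun m => hG (R.cochainComplex.X m) inferInstance
  let Y := DerivedCategory.Plus.Q.obj L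
  have e (m : ℕ) : (DerivedCategory.Plus.homologyFunctor D m).obj Y ≅ (G.rightDerived m).obj X :=
    DerivedCategory.Plus.homologyFunctorObjQObjIso L m ≪≫ G.homologyMapCochainComplexIso R m
  have hY : Y.IsLE 0 := by
    rw [← DerivedCategory.Plus.isLE_ι_obj_iff, DerivedCategory.isLE_iff]
    intro i hi
    obtain ⟨k, rfl⟩ := Int.le.dest (show 1 ≤ i by lia)
    have hk : (1 + k : ℤ) = (k + 1 : ℕ) := by push_cast; ring
    rw [hk]
    exact (hX k).of_iso (e (k + 1))
  obtain ⟨e'⟩ := DerivedCategory.Plus.nonempty_iso_singleFunctor_obj Y 0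
  exact ⟨((F.hypercohomologyIsoOfInjective L n).trans
      ((G ⋙ F).homologyMapCochainComplexIso R n)).symm ≪≫
    (F.hypercohomology.shift (n : ℤ)).mapIso (e' ≪≫ (DerivedCategory.Plus.singleFunctor D 0).mapIso
      (e 0 ≪≫ G.rightDerivedZeroIsoSelf.app X)) ≪≫
    F.hypercohomologySingleIso (G.obj X) n⟩

end

end CategoryTheory.Functor

/-! ### Coinduced inverse systems and acyclicity for the limit -/

namespace InvSys

variable (P : Type w) [PartialOrder P] [Finite P] (A : Type u) [CommRing A]

instance (a b : Pᵒᵖ) : HasProductsOfShape (a ⟶ b) (ModuleCat.{u} A) :=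
  hasLimitsOfShape_discrete _ (a ⟶ b)

variable {P} in
/-- The right adjoint of the evaluation functor. -/
abbrev coind (p : Pᵒᵖ) : ModuleCat.{u} A ⥤ InvSys P A :=
  evaluationRightAdjoint (ModuleCat.{u} A) p

variable {P}

instance (p : Pᵒᵖ) : (coind A p).IsRightAdjoint := (evaluationAdjunctionLeft _ p).isRightAdjoint

variable {A} in
lemma coind_map_app_π (p : Pᵒᵖ) {M N : ModuleCat.{u} A} (f : M ⟶ N) {t : Pᵒᵖ} (g : t ⟶ p) :
    ((coind A p).map f).app t ≫ Pi.π (fun _ : t ⟶ p => N) g =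
      Pi.π (fun _ : t ⟶ p => M) g ≫ f :=
  Pi.lift_π _ _

variable {A} in
lemma coind_obj_map_π (p : Pᵒᵖ) (M : ModuleCat.{u} A) {s t : Pᵒᵖ} (f : s ⟶ t) (g : t ⟶ p) :
    ((coind A p).obj M).map f ≫ Pi.π (fun _ : t ⟶ p => M) g =
      Pi.π (fun _ : s ⟶ p => M) (f ≫ g) :=
  Pi.lift_π _ _

instance (p : Pᵒᵖ) : (coind A p).Additive where
  map_add {M N f f'} := by
    ext t : 2
    refine Pi.hom_ext _ _ (fun g => ?_)
    refine (coind_map_app_π p (f + f') g).trans (Eq.symm ?_)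
    refine (Preadditive.add_comp _ _ _ (((coind A p).map f).app t)
      (((coind A p).map f').app t) (Pi.π (fun _ : t ⟶ p => N) g)).trans ?_
    exact (congrArg₂ (· + ·) (coind_map_app_π p f g) (coind_map_app_π p f' g)).trans
      (Preadditive.comp_add _ _ _ _ _ _).symm

/-- The sets `t ⟶ p` are finite, so the products are biproducts and a product of epimorphisms is
epi. -/
instance (p : Pᵒᵖ) : (coind A p).PreservesEpimorphisms where
  preserves {M N} f _ := by
    have (t : Pᵒᵖ) : Epi (((coind A p).map f).app t) := by
      have h_map : ((coind A p).map f).app t = Limits.Pi.map (fun _ : t ⟶ p => f) :=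
        Pi.hom_ext _ _ (fun g => (coind_map_app_π p f g).trans
          (Limits.Pi.map_π (fun _ : t ⟶ p => f) g).symm)
      have h (K : ModuleCat.{u} A) : HasBiproduct (fun _ : t ⟶ p => K) := inferInstance
      have := h M
      have := h N
      rw [h_map]
      exact Limits.Pi.map_epi (fun _ : t ⟶ p => f)
    exact NatTrans.epi_of_epi_app _

instance (p : Pᵒᵖ) : (coind A p).PreservesHomology :=
  Functor.preservesHomology_of_preservesEpis_and_kernels _

instance (p : Pᵒᵖ) (E : ModuleCat.{u} A) [Injective E] : Injective ((coind A p).obj E) :=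
  Injective.injective_of_adjoint (evaluationAdjunctionLeft (ModuleCat.{u} A) p) _

/-- The limit of a coinduced inverse system. -/
def coindCompLimitIso (p : Pᵒᵖ) : coind A p ⋙ InvSys.limit P A ≅ 𝟭 _ :=
  -- Evaluating a constant system returns the module, so both functors are right adjoint to `𝟭`.
  ((constLimAdj.comp (evaluationAdjunctionLeft (ModuleCat.{u} A) p)).ofNatIsoLeft
    (Iso.refl (𝟭 (ModuleCat.{u} A)))).rightAdjointUniq Adjunction.id

/-- Since `coind` is exact and preserves injectives, `ℝⁿ lim (coind M)` is the `n`-th derived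
functor of `lim ∘ coind ≅ 𝟭` at `M`. -/
lemma isRightAcyclic_coind_obj (p : Pᵒᵖ) (M : ModuleCat.{u} A) :
    (InvSys.limit P A).IsRightAcyclic ((coind A p).obj M) := by
  intro n
  obtain ⟨e⟩ := (coind A p).nonempty_rightDerived_comp_iso (InvSys.limit P A)
    (fun _ _ => inferInstance) M ((coind A p).isRightAcyclic_of_preservesHomology M) (n + 1)
  obtain ⟨e'⟩ := Functor.nonempty_rightDerived_iso (coindCompLimitIso A p) (n + 1) M
  exact ((𝟭 _ : ModuleCat.{u} A ⥤ _).isRightAcyclic_of_preservesHomology M n).of_iso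
    (e.symm ≪≫ e')

variable {A}

/-- The pointwise extension of an additive functor commutes with coinduction. -/
def coindCompExtendIso (T : ModuleCat.{u} A ⥤ ModuleCat.{u} A) [T.Additive] (p : Pᵒᵖ)
    (M : ModuleCat.{u} A) :
    (InvSys.extend P T).obj ((coind A p).obj M) ≅ (coind A p).obj (T.obj M) :=
  NatIso.ofComponents (fun t => PreservesProduct.iso T (fun _ : t ⟶ p => M)) (by
    intro s t f
    refine Pi.hom_ext _ _ (fun g => ?_)
    have h₁ : T.map (((coind A p).obj M).map f) ≫ T.map (Pi.π (fun _ : t ⟶ p => M) g) =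
        T.map (Pi.π (fun _ : s ⟶ p => M) (f ≫ g)) :=
      (T.map_comp _ _).symm.trans (congrArg T.map (coind_obj_map_π p M f g))
    refine (Category.assoc _ _ _).trans ((congrArg (_ ≫ ·) (piComparison_comp_π _ _ _)).trans ?_)
    refine h₁.trans (Eq.symm ((Category.assoc _ _ _).trans ?_))
    refine (congrArg (_ ≫ ·) (coind_obj_map_π p (T.obj M) f g)).trans ?_
    exact piComparison_comp_π _ _ _)

/-- The units embed `I` in a finite product of coinduced systems. Injectivity splits the embedding,
and the additive functor `N` kills the product. -/
lemma isZero_obj_of_injective {D : Type*} [Category* D] [Preadditive D]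
    (N : InvSys P A ⥤ D) [N.Additive]
    (hN : ∀ (p : Pᵒᵖ) (M : ModuleCat.{u} A), IsZero (N.obj ((coind A p).obj M)))
    (I : InvSys P A) [Injective I] : IsZero (N.obj I) := by
  let η (p : Pᵒᵖ) : I ⟶ (coind A p).obj (I.obj p) :=
    (evaluationAdjunctionLeft (ModuleCat.{u} A) p).unit.app I
  have hη (p : Pᵒᵖ) : (η p).app p ≫
      (evaluationAdjunctionLeft (ModuleCat.{u} A) p).counit.app (I.obj p) = 𝟙 _ :=
    (evaluationAdjunctionLeft (ModuleCat.{u} A) p).left_triangle_components I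
  let f : I ⟶ ∏ᶜ fun p => (coind A p).obj (I.obj p) := Pi.lift η
  have hf : Mono f := by
    have (p : Pᵒᵖ) : Mono (f.app p) := by
      have : f.app p ≫ (Pi.π (fun p => (coind A p).obj (I.obj p)) p).app p ≫
          (evaluationAdjunctionLeft (ModuleCat.{u} A) p).counit.app (I.obj p) = 𝟙 _ := by
        rw [← NatTrans.comp_app_assoc, Pi.lift_π, hη]
      exact (SplitMono.mk _ this).mono
    exact NatTrans.mono_of_mono_app _
  have : Finite Pᵒᵖ := Finite.of_equiv P Opposite.equivToOpposite
  have hz : IsZero (N.obj (∏ᶜ fun p => (coind A p).obj (I.obj p))) := by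
    rw [IsZero.iff_id_eq_zero]
    exact (isLimitOfPreserves N (limit.isLimit _)).hom_ext
      (fun p => (hN p.as (I.obj p.as)).eq_of_tgt _ _)
  rw [IsZero.iff_id_eq_zero, ← N.map_id, ← Injective.comp_factorThru (𝟙 I) f, N.map_comp,
    hz.eq_of_tgt (N.map f) 0, zero_comp]

lemma isRightAcyclic_extend_obj (T : ModuleCat.{u} A ⥤ ModuleCat.{u} A) [T.Additive]
    (I : InvSys P A) [Injective I] :
    (InvSys.limit P A).IsRightAcyclic ((InvSys.extend P T).obj I) := fun n =>
  isZero_obj_of_injective (InvSys.extend P T ⋙ (InvSys.limit P A).rightDerived (n + 1))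
    (fun p M => (isRightAcyclic_coind_obj A p (T.obj M) n).of_iso
      (((InvSys.limit P A).rightDerived (n + 1)).mapIso (coindCompExtendIso T p M))) I

end InvSys

end

/-! ### The spectral sequence for the limit -/

theorem mainTheorem2 {A : Type u} [CommRing A] [IsNoetherianRing A]
    {P : Type w} [PartialOrder P] [Finite P]
    (T : ModuleCat.{u} A ⥤ ModuleCat.{u} A) [T.Additive] [PreservesFiniteLimits T]
    (hT : IsAdmissible T) (V : InvSys P A) :
    ∃ E : E₂CohomologicalSpectralSequenceNat (ModuleCat.{u} A),
      (∀ i j : ℕ, Nonempty ((E.page 2).X (i, j) ≅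
        ((InvSys.limit P A).rightDerived i).obj (((InvSys.extend P T).rightDerived j).obj V))) ∧
      SpectralConvergesTo E
        (fun n => ((InvSys.extend P T ⋙ InvSys.limit P A).rightDerived n).obj V) ∧
      (Nonempty (InvSys.extend P T ⋙ InvSys.limit P A ≅ InvSys.limit P A ⋙ T) →
        (∀ i : ℕ, 0 < i → IsZero (((InvSys.limit P A).rightDerived i).obj V)) →
        (∀ n : ℕ, Nonempty (((InvSys.extend P T ⋙ InvSys.limit P A).rightDerived n).obj V ≅
          (T.rightDerived n).obj ((InvSys.limit P A).obj V))) ∧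
        SpectralConvergesTo E
          (fun n => (T.rightDerived n).obj ((InvSys.limit P A).obj V))) := by
  obtain ⟨E, h₂, hE⟩ := exists_grothendieckSpectralSequence (InvSys.extend P T) (InvSys.limit P A)
    (fun I _ => InvSys.isRightAcyclic_extend_obj T I) V
  -- `hE` accepts any graded object termwise isomorphic to the derived functors of the composite, so
  -- one and the same `E` serves both abutments.
  refine ⟨E, h₂ _, hE _ (fun n => ⟨Iso.refl _⟩), fun ⟨e⟩ hV => ?_⟩
  have key (n : ℕ) : Nonempty (((InvSys.extend P T ⋙ InvSys.limit P A).rightDerived n).obj V ≅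
      (T.rightDerived n).obj ((InvSys.limit P A).obj V)) := by
    obtain ⟨e₁⟩ := Functor.nonempty_rightDerived_iso e n V
    obtain ⟨e₂⟩ := (InvSys.limit P A).nonempty_rightDerived_comp_iso T
      (fun I _ => Injective.injective_of_adjoint constLimAdj I) V (fun i => hV _ i.succ_pos) n
    exact ⟨e₁ ≪≫ e₂⟩
  exact ⟨key, hE _ key⟩
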